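/- For a word $w$ of $m$ distinct integers, a position strictly between the first and the last is a change of direction if its letter is larger than both neighbouring letters or smaller than both; the number of alternating runs of $w$ is $0$ if $m\le 1$ and otherwise one more than the number of changes of direction (for $m \ge 2$ this is the number of maximal intervals of at least two consecutive positions on which $w$ is monotonic). For $n,k\ge 0$ let $M(n,k)$ be the number of permutations $\pi$ of $[n]=\{1,\dots,n\}$ such that the word $0\,\pi(1)\cdots\pi(n)$ has $k$ alternating runs (the up-down runs of $\pi$), and let $M_n(x)=\sum_{k=0}^n M(n,k)x^k$; thus $M_0(x)=1$. Let $B_n$ be the hyperoctahedral group of signed permutations, that is, of permutations $\pi$ of $\{\pm1,\dots,\pm n\}$ with $\pi(-i)=-\pi(i)$ for all $i$. For $n,k\ge 1$ let $T(n,k)$ be the number of $\pi\in B_n$ with $\pi(1)>0$ such that the word $0\,\pi(1)\cdots\pi(n)$ has $k$ runs, i.e. maximal intervals of at least two consecutive positions on which it is monotonic, and let $T_n(x)=\sum_{k=1}^n T(n,k)x^k$. Then for every integer $n\ge 0$, as polynomials in $x$, $$T_{n+1}(x)=2^n x M_n(x)+(1+x)\sum_{k=1}^n 2^{n-k}\binom{n}{k}T_k(x)M_{n-k}(x).$$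 -/

import Mathlib

namespace RunPolynomials

/-- The position `i` of the word `w` (with positions `0, …, m - 1`) is a change of direction:
it has a left neighbour `a` and a right neighbour `c`, and `w i` is either larger than both
neighbouring letters or smaller than both. -/
def ChangesDirectionAt {m : ℕ} (w : Fin m → ℤ) (i : Fin m) : Prop :=
  ∃ a c : Fin m, (a : ℕ) + 1 = i ∧ (i : ℕ) + 1 = c ∧
    ((w a < w i ∧ w c < w i) ∨ (w i < w a ∧ w i < w c))

instance {m : ℕ} (w : Fin m → ℤ) (i : Fin m) : Decidable (ChangesDirectionAt w i) :=
  inferInstanceAs (Decidable (∃ _ _, _))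

/-- The number of alternating runs of a word with pairwise distinct letters: one more than the
number of changes of direction, except that a word with at most one letter has no run. -/
def numAlternatingRuns {m : ℕ} (w : Fin m → ℤ) : ℕ :=
  if m ≤ 1 then 0 else (Finset.univ.filter fun i => ChangesDirectionAt w i).card + 1

/-- The word `0 π(1) ⋯ π(n)` of a permutation `π` of `[n]`. `Fin n` stands for `[n]`, its element
`i` standing for `i + 1`. -/
def permWord {n : ℕ} (π : Equiv.Perm (Fin n)) : Fin (n + 1) → ℤ :=
  Fin.cons 0 fun i => ((π i : ℕ) : ℤ) + 1

/-- The number of up-down runs of `π`: the number of alternating runs of `0 π(1) ⋯ π(n)`. -/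
def numUpDownRuns {n : ℕ} (π : Equiv.Perm (Fin n)) : ℕ :=
  numAlternatingRuns (permWord π)

/-- `M(n, k)`: the number of permutations of `[n]` with `k` up-down runs. -/
def M (n k : ℕ) : ℕ :=
  (Finset.univ.filter fun π : Equiv.Perm (Fin n) => numUpDownRuns π = k).card

/-- The up-down run polynomial `M_n(x) = ∑_k M(n, k) x ^ k`. As `M(n, 0) = 0` for `n ≥ 1` and
`M(0, 0) = 1`, the term `k = 0` matters only for `n = 0`, where it gives `M_0(x) = 1`. -/
noncomputable def upDownRunPoly (n : ℕ) : Polynomial ℤ :=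
  ∑ k ∈ Finset.Icc 0 n, (M n k : Polynomial ℤ) * Polynomial.X ^ k

/-- The set `±[n] = {±1, …, ±n}`. -/
abbrev PMSet (n : ℕ) : Type :=
  ↥((Finset.Icc (-(n : ℤ)) (n : ℤ)).erase 0)

/-- The element `i + 1` of `[n] ⊆ ±[n]`, for `i = 0, …, n - 1`. -/
def PMSet.pos {n : ℕ} (i : Fin n) : PMSet n :=
  ⟨(i : ℕ) + 1, by
    have := i.isLt
    simp only [Finset.mem_erase, Finset.mem_Icc]
    omega⟩

/-- The hyperoctahedral group `B_n`: the permutations `π` of `±[n]` with `π(-i) = -π(i)`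
for all `i`. -/
abbrev SignedPerm (n : ℕ) : Type :=
  {π : Equiv.Perm (PMSet n) // ∀ i j : PMSet n, (j : ℤ) = -(i : ℤ) → (π j : ℤ) = -(π i : ℤ)}

/-- The word `0 π(1) ⋯ π(n)` of a signed permutation `π`. -/
def signedWord {n : ℕ} (π : SignedPerm n) : Fin (n + 1) → ℤ :=
  Fin.cons 0 fun i => (π.1 (PMSet.pos i) : ℤ)

/-- An up signed permutation: `π(1) > 0`. -/
def IsUp {n : ℕ} (π : SignedPerm n) : Prop :=
  ∀ i : PMSet n, (i : ℤ) = 1 → 0 < (π.1 i : ℤ)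

noncomputable instance {n : ℕ} (π : SignedPerm n) : Decidable (IsUp π) :=
  inferInstanceAs (Decidable (∀ i : PMSet n, (i : ℤ) = 1 → 0 < (π.1 i : ℤ)))

/-- The word `w` is monotonic (increasing or decreasing) on the positions `a, …, b`. -/
def IsMonotonicBetween {m : ℕ} (w : Fin m → ℤ) (a b : Fin m) : Prop :=
  StrictMonoOn w (Set.Icc a b) ∨ StrictAntiOn w (Set.Icc a b)

instance {m : ℕ} (w : Fin m → ℤ) (a b : Fin m) : Decidable (IsMonotonicBetween w a b) :=
  inferInstanceAs (Decidable
    ((∀ i, i ∈ Set.Icc a b → ∀ j, j ∈ Set.Icc a b → i < j → w i < w j) ∨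
      (∀ i, i ∈ Set.Icc a b → ∀ j, j ∈ Set.Icc a b → i < j → w j < w i)))

/-- The interval of positions `a, …, b` (with at least two positions) is a run of `w`: a maximal
interval on which `w` is monotonic. -/
def IsRun {m : ℕ} (w : Fin m → ℤ) (a b : Fin m) : Prop :=
  a < b ∧ IsMonotonicBetween w a b ∧
    ∀ c d : Fin m, c ≤ a → b ≤ d → IsMonotonicBetween w c d → c = a ∧ d = b

instance {m : ℕ} (w : Fin m → ℤ) (a b : Fin m) : Decidable (IsRun w a b) :=
  inferInstanceAs (Decidable (_ ∧ _ ∧ ∀ _ _, _ → _ → _ → _))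

/-- The number of (alternating) runs of a signed permutation. -/
def numSignedRuns {n : ℕ} (π : SignedPerm n) : ℕ :=
  (Finset.univ.filter fun p : Fin (n + 1) × Fin (n + 1) => IsRun (signedWord π) p.1 p.2).card

/-- `T(n, k)`: the number of up signed permutations in `B_n` with `k` alternating runs. -/
noncomputable def T (n k : ℕ) : ℕ :=
  (Finset.univ.filter fun π : SignedPerm n => IsUp π ∧ numSignedRuns π = k).card

/-- The alternating run polynomial of type `B`, `T_n(x) = ∑_{k=1}^n T(n, k) x ^ k`. -/
noncomputable def altRunPolyB (n : ℕ) : Polynomial ℤ :=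
  ∑ k ∈ Finset.Icc 1 n, (T n k : Polynomial ℤ) * Polynomial.X ^ k

end RunPolynomials

open Polynomial

namespace RunPolynomials

/-! Cut the word of an up signed permutation of `[n+1]` at its letter `±N`, `N = n + 1`, as `u (±N)
v`, and sum `x ^ runs` over all pieces. Since `±N` exceeds, or is below, every other letter
including the initial `0`, the runs of `0 u (±N) v` are those of `0 u (±N)` together with those of
`(±N) v` (`listRuns_append_cons`).

The right factor sums to `2 ^ |v| * M_{|v|}(x)` for either sign of `N`: after a choice of signs for
`v`, the first letter is still extreme, and an order isomorphism or anti-isomorphism turns it into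
the initial `0` of an up-down word (`sum_arrangements_pow_listRuns`). If `u` is nonempty, exactly
one of `N` and `-N` prolongs the last run of `0 u`, so the two signs together contribute `(1 + x) *
x ^ runs(0 u)` (`pow_listRuns_add_pow_listRuns`); summing over up words `u` on a set of `k` absolute
values gives `T_k(x)` (`sum_arrangements_up`), and there are `n.choose k` such sets. If `u` is
empty, only `+N` is allowed, and the step from `0` to `N` contributes the single factor `x`. -/

/-! ### Changes of direction of words and of lists. -/

/-- The number of changes of direction of a list of integers. -/
def dirChanges : List ℤ → ℕ
  | a :: b :: c :: t =>
      (if (a < b ∧ c < b) ∨ (b < a ∧ b < c) then 1 else 0) + dirChanges (b :: c :: t)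
  | _ => 0

/-- The number of alternating runs of a list of integers. -/
def listRuns (l : List ℤ) : ℕ :=
  if l.length ≤ 1 then 0 else dirChanges l + 1

theorem changesDirectionAt_zero {m : ℕ} (w : Fin (m + 1) → ℤ) : ¬ ChangesDirectionAt w 0 := by
  rintro ⟨a, c, h, -⟩
  simp at h

theorem changesDirectionAt_one {m : ℕ} (w : Fin (m + 3) → ℤ) :
    ChangesDirectionAt w (Fin.succ 0) ↔ (w 0 < w 1 ∧ w 2 < w 1) ∨ (w 1 < w 0 ∧ w 1 < w 2) := by
  constructor
  · rintro ⟨a, c, ha, hc, h⟩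
    have ha' : a = 0 := by ext; simpa using ha
    have hc' : c = Fin.succ (Fin.succ 0) := by ext; exact hc.symm
    subst ha' hc'
    exact h
  · intro h
    exact ⟨0, Fin.succ (Fin.succ 0), rfl, rfl, h⟩

theorem changesDirectionAt_succ_succ {m : ℕ} (w : Fin (m + 3) → ℤ) (j : Fin (m + 1)) :
    ChangesDirectionAt w j.succ.succ ↔ ChangesDirectionAt (fun i => w i.succ) j.succ := by
  constructor
  · rintro ⟨a, c, ha, hc, h⟩
    have ha0 : a ≠ 0 := by rintro rfl; simp at ha
    have hc0 : c ≠ 0 := by rintro rfl; simp at hc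
    obtain ⟨a, rfl⟩ := Fin.exists_succ_eq.2 ha0
    obtain ⟨c, rfl⟩ := Fin.exists_succ_eq.2 hc0
    exact ⟨a, c, by simpa using ha, by simpa using hc, h⟩
  · rintro ⟨a, c, ha, hc, h⟩
    exact ⟨a.succ, c.succ, by simpa using ha, by simpa using hc, h⟩

theorem card_changesDirectionAt : ∀ {m : ℕ} (w : Fin m → ℤ),
    (Finset.univ.filter fun i => ChangesDirectionAt w i).card = dirChanges (List.ofFn w)
  | 0, w => by simp [dirChanges]
  | 1, w => by
    simp only [List.ofFn_succ, List.ofFn_zero, dirChanges, Finset.card_eq_zero]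
    refine Finset.filter_eq_empty_iff.2 ?_
    rintro i - ⟨a, c, h, h', -⟩
    omega
  | 2, w => by
    simp only [List.ofFn_succ, List.ofFn_zero, dirChanges, Finset.card_eq_zero]
    refine Finset.filter_eq_empty_iff.2 ?_
    rintro i - ⟨a, c, h, h', -⟩
    omega
  | m + 3, w => by
    have ih := card_changesDirectionAt (fun i : Fin (m + 2) => w i.succ)
    rw [Finset.card_filter, Fin.sum_univ_succ, if_neg (changesDirectionAt_zero _), zero_add] at ih ⊢
    rw [Fin.sum_univ_succ]
    simp only [changesDirectionAt_succ_succ, changesDirectionAt_one]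
    rw [ih]
    simp only [List.ofFn_succ, dirChanges]
    rfl

theorem numAlternatingRuns_eq_listRuns {m : ℕ} (w : Fin m → ℤ) :
    numAlternatingRuns w = listRuns (List.ofFn w) := by
  simp [numAlternatingRuns, listRuns, card_changesDirectionAt]

theorem numAlternatingRuns_congr {m : ℕ} {w w' : Fin m → ℤ}
    (h : ∀ i j, w i < w j ↔ w' i < w' j) : numAlternatingRuns w = numAlternatingRuns w' := by
  have key : ∀ i, ChangesDirectionAt w i ↔ ChangesDirectionAt w' i := fun i => by
    simp only [ChangesDirectionAt, h]
  simp only [numAlternatingRuns, key]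

theorem numAlternatingRuns_congr_reverse {m : ℕ} {w w' : Fin m → ℤ}
    (h : ∀ i j, w i < w j ↔ w' j < w' i) : numAlternatingRuns w = numAlternatingRuns w' := by
  have key : ∀ i, ChangesDirectionAt w i ↔ ChangesDirectionAt w' i := fun i => by
    simp only [ChangesDirectionAt, h, or_comm]
  simp only [numAlternatingRuns, key]

theorem dirChanges_le : ∀ l : List ℤ, dirChanges l ≤ l.length - 2
  | [] | [_] | [_, _] => by simp [dirChanges]
  | a :: b :: c :: t => by
    have := dirChanges_le (b :: c :: t)
    simp only [dirChanges, List.length_cons] at this ⊢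
    split_ifs <;> omega

theorem numAlternatingRuns_le {n : ℕ} (w : Fin (n + 1) → ℤ) : numAlternatingRuns w ≤ n := by
  rw [numAlternatingRuns_eq_listRuns, listRuns]
  have := dirChanges_le (List.ofFn w)
  simp only [List.length_ofFn] at this ⊢
  split_ifs <;> omega

theorem one_le_numAlternatingRuns {n : ℕ} (hn : 1 ≤ n) (w : Fin (n + 1) → ℤ) :
    1 ≤ numAlternatingRuns w := by
  rw [numAlternatingRuns, if_neg (by omega)]
  omega

/-! ### Cutting a word at an extreme letter. -/

/-- The term `1` is the change of direction at `N`; any other three consecutive letters lie entirely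
on one side of the cut, with `N` belonging to both sides. -/
theorem dirChanges_append_cons {N c : ℤ} (v : List ℤ) : ∀ (u : List ℤ), u ≠ [] →
    ((∀ z ∈ u, z < N) ∧ c < N ∨ (∀ z ∈ u, N < z) ∧ N < c) →
    dirChanges (u ++ N :: c :: v) = dirChanges (u ++ [N]) + 1 + dirChanges (N :: c :: v)
  | [], h, _ => absurd rfl h
  | [a], _, h => by
    have : (a < N ∧ c < N) ∨ (N < a ∧ N < c) := by simpa using h
    simp [dirChanges, this]
  | [a, b], _, h => by
    have h' : (b < N ∧ c < N) ∨ (N < b ∧ N < c) :=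
      h.imp (fun h => ⟨h.1 b (by simp), h.2⟩) (fun h => ⟨h.1 b (by simp), h.2⟩)
    simp only [List.cons_append, List.nil_append, dirChanges, if_pos h']
    omega
  | a :: b :: d :: t, _, h => by
    have ih := dirChanges_append_cons (N := N) (c := c) v (b :: d :: t) (by simp)
      (h.imp (fun h => ⟨fun z hz => h.1 z (List.mem_cons_of_mem _ hz), h.2⟩)
        (fun h => ⟨fun z hz => h.1 z (List.mem_cons_of_mem _ hz), h.2⟩))
    simp only [List.cons_append, dirChanges] at ih ⊢
    omega

/-- The change of direction at `N` supplies the second `+ 1` needed for two run counts. An empty `v`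
fits because a one-letter word has no run. -/
theorem listRuns_append_cons {N : ℤ} {u v : List ℤ} (hu : u ≠ [])
    (h : (∀ z ∈ u ++ v, z < N) ∨ (∀ z ∈ u ++ v, N < z)) :
    listRuns (u ++ N :: v) = listRuns (u ++ [N]) + listRuns (N :: v) := by
  have hl : 0 < u.length := List.length_pos_iff.2 hu
  cases v with
  | nil => simp [listRuns]
  | cons c v =>
    have := dirChanges_append_cons (N := N) (c := c) v u hu
      (h.imp (fun h => ⟨fun z hz => h z (by simp [hz]), h c (by simp)⟩)
        (fun h => ⟨fun z hz => h z (by simp [hz]), h c (by simp)⟩))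
    simp only [listRuns, List.length_append, List.length_cons, List.length_nil]
    rw [if_neg (by omega), if_neg (by omega), if_neg (by omega), this]
    omega

/-- Of the final letters `N` and `-N`, one continues the direction of the last step and the other
reverses it. Earlier changes of direction are a common factor. -/
theorem pow_dirChanges_add_pow_dirChanges {N : ℤ} (x : ℤ[X]) : ∀ (t : List ℤ) (a b : ℤ),
    (a :: b :: t).Nodup → (∀ z ∈ a :: b :: t, |z| < N) →
    x ^ dirChanges (a :: b :: t ++ [N]) + x ^ dirChanges (a :: b :: t ++ [-N]) =
      (1 + x) * x ^ dirChanges (a :: b :: t)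
  | [], a, b, hd, h => by
    have hab : a ≠ b := by simpa using hd
    have hb := abs_lt.1 (h b (by simp))
    simp only [List.cons_append, List.nil_append, dirChanges]
    rcases lt_or_gt_of_ne hab with hab | hab
    · rw [if_neg (by omega), if_pos (by omega)]; ring
    · rw [if_pos (by omega), if_neg (by omega)]; ring
  | c :: t, a, b, hd, h => by
    have ih := pow_dirChanges_add_pow_dirChanges x t b c hd.of_cons
      (fun z hz => h z (List.mem_cons_of_mem _ hz))
    simp only [List.cons_append, dirChanges, pow_add] at ih ⊢
    rw [← mul_add, ih]
    ring

/-- A last step must exist: for `l = []` both extensions have one run and the sum would be `2 * x`.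
This is why the empty prefix is a separate case of the recurrence. -/
theorem pow_listRuns_add_pow_listRuns {N : ℤ} (x : ℤ[X]) {a : ℤ} {l : List ℤ} (hl : l ≠ [])
    (hd : (a :: l).Nodup) (h : ∀ z ∈ a :: l, |z| < N) :
    x ^ listRuns (a :: l ++ [N]) + x ^ listRuns (a :: l ++ [-N]) =
      (1 + x) * x ^ listRuns (a :: l) := by
  obtain ⟨b, t, rfl⟩ := List.exists_cons_of_ne_nil hl
  have := pow_dirChanges_add_pow_dirChanges x t a b hd h
  simp only [listRuns, List.length_append, List.length_cons, List.length_nil] at this ⊢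
  rw [if_neg (by omega), if_neg (by omega), if_neg (by omega), pow_succ, pow_succ, pow_succ,
    ← add_mul, this]
  ring

/-! ### Runs as maximal monotonic intervals. -/

section Runs

variable {m : ℕ} {w : Fin m → ℤ}

theorem strictMonoOn_Icc_of_succ {a b c : Fin m} {u : Fin m → ℤ} (hac : (a : ℕ) + 1 = c)
    (hlt : u a < u c) (h : StrictMonoOn u (Set.Icc c b)) : StrictMonoOn u (Set.Icc a b) := by
  intro i hi j hj hij
  have hcj : c ≤ j := Fin.le_def.2 (by have := hi.1; omega)
  rcases eq_or_lt_of_le hi.1 with rfl | hai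
  · exact hlt.trans_le (h.monotoneOn ⟨le_rfl, hcj.trans hj.2⟩ ⟨hcj, hj.2⟩ hcj)
  · exact h ⟨Fin.le_def.2 (by omega), hi.2⟩ ⟨hcj, hj.2⟩ hij

theorem strictAntiOn_Icc_of_succ {a b c : Fin m} {u : Fin m → ℤ} (hac : (a : ℕ) + 1 = c)
    (hlt : u c < u a) (h : StrictAntiOn u (Set.Icc c b)) : StrictAntiOn u (Set.Icc a b) := by
  intro i hi j hj hij
  have hcj : c ≤ j := Fin.le_def.2 (by have := hi.1; omega)
  rcases eq_or_lt_of_le hi.1 with rfl | hai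
  · exact (h.antitoneOn ⟨le_rfl, hcj.trans hj.2⟩ ⟨hcj, hj.2⟩ hcj).trans_lt hlt
  · exact h ⟨Fin.le_def.2 (by omega), hi.2⟩ ⟨hcj, hj.2⟩ hij

theorem isMonotonicBetween_succ (hw : Function.Injective w) {a b : Fin m}
    (hab : (a : ℕ) + 1 = b) : IsMonotonicBetween w a b := by
  have key : ∀ i ∈ Set.Icc a b, ∀ j ∈ Set.Icc a b, i < j → i = a ∧ j = b := by
    rintro i ⟨hi, hi'⟩ j ⟨hj, hj'⟩ hij
    constructor <;> ext <;> omega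
  have hne : w a ≠ w b := fun h => by have := hw h; subst this; omega
  rcases lt_or_gt_of_ne hne with h | h
  · left
    intro i hi j hj hij
    obtain ⟨rfl, rfl⟩ := key i hi j hj hij
    exact h
  · right
    intro i hi j hj hij
    obtain ⟨rfl, rfl⟩ := key i hi j hj hij
    exact h

theorem IsMonotonicBetween.not_changesDirectionAt {a b i : Fin m} (h : IsMonotonicBetween w a b)
    (hai : a < i) (hib : i < b) : ¬ ChangesDirectionAt w i := by
  rintro ⟨c, d, hc, hd, hcd⟩
  have hci : c < i := Fin.lt_def.2 (by omega)
  have hid : i < d := Fin.lt_def.2 (by omega)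
  have hcm : c ∈ Set.Icc a b := ⟨Fin.le_def.2 (by omega), (hci.trans hib).le⟩
  have hdm : d ∈ Set.Icc a b := ⟨(hai.trans hid).le, Fin.le_def.2 (by omega)⟩
  have him : i ∈ Set.Icc a b := ⟨hai.le, hib.le⟩
  rcases h with h | h
  · have h1 := h hcm him hci
    have h2 := h him hdm hid
    omega
  · have h1 := h hcm him hci
    have h2 := h him hdm hid
    omega

/-- A run starts at the first position or at a change of direction. -/
theorem IsRun.eq_zero_or_changesDirectionAt (hw : Function.Injective w) {a b : Fin m}
    (h : IsRun w a b) : (a : ℕ) = 0 ∨ ChangesDirectionAt w a := by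
  by_contra! hcon
  obtain ⟨ha0, hcd⟩ := hcon
  obtain ⟨hab, hmono, hmax⟩ := h
  -- Without a change of direction at `a`, the step from `p` to `a` goes the same way as the step
  -- from `a` to `q`, so the run extends to the left, against maximality.
  let p : Fin m := ⟨a - 1, by omega⟩
  let q : Fin m := ⟨a + 1, by omega⟩
  have hp : (p : ℕ) + 1 = a := Nat.succ_pred ha0
  have hq : (a : ℕ) + 1 = q := rfl
  have hpa : p ≠ a := fun h => by rw [h] at hp; omega
  have hqa : q ≠ a := fun h => by rw [h] at hq; omega
  have hnot : ¬ ((w p < w a ∧ w q < w a) ∨ (w a < w p ∧ w a < w q)) :=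
    fun h => hcd ⟨p, q, hp, hq, h⟩
  have hpa' := hw.ne hpa
  have hqa' := hw.ne hqa
  have haq : a < q := Fin.lt_def.2 (by omega)
  have hqb : q ≤ b := Fin.le_def.2 (by omega)
  have hext : IsMonotonicBetween w p b := by
    rcases hmono with h | h
    · have := h ⟨le_rfl, hab.le⟩ ⟨haq.le, hqb⟩ haq
      exact Or.inl (strictMonoOn_Icc_of_succ hp (by omega) h)
    · have := h ⟨le_rfl, hab.le⟩ ⟨haq.le, hqb⟩ haq
      exact Or.inr (strictAntiOn_Icc_of_succ hp (by omega) h)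
  exact hpa (hmax p b (Fin.le_def.2 (by omega)) le_rfl hext).1

/-- Take the largest `b` for which the interval from `a` is monotonic. It cannot grow to the left,
since `a` is either the first position or would become an interior change of direction. -/
theorem exists_isRun (hw : Function.Injective w) {a : Fin m} (ham : (a : ℕ) + 1 < m)
    (ha : (a : ℕ) = 0 ∨ ChangesDirectionAt w a) : ∃ b, IsRun w a b := by
  classical
  let s : Finset (Fin m) := Finset.univ.filter fun b => IsMonotonicBetween w a b
  have hs : (⟨a + 1, ham⟩ : Fin m) ∈ s := by
    simpa [s] using isMonotonicBetween_succ hw rfl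
  obtain ⟨b, hb, hbmax⟩ := s.exists_max_image id ⟨_, hs⟩
  have hb' : IsMonotonicBetween w a b := (Finset.mem_filter.1 hb).2
  have hab : a < b := lt_of_lt_of_le (Fin.lt_def.2 (Nat.lt_succ_self _)) (hbmax _ hs)
  refine ⟨b, hab, hb', fun c d hca hbd hcd => ?_⟩
  have hca' : c = a := by
    by_contra hne
    have hlt : c < a := lt_of_le_of_ne hca hne
    rcases ha with h0 | h0
    · have := Fin.lt_def.1 hlt
      omega
    · exact hcd.not_changesDirectionAt hlt (hab.trans_le hbd) h0
  subst hca'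
  exact ⟨rfl, le_antisymm (hbmax d (by simpa [s] using hcd)) hbd⟩

end Runs

/-- A run is determined by its left endpoint, and the left endpoints are the first position and the
changes of direction. -/
theorem card_isRun {n : ℕ} {w : Fin (n + 1) → ℤ} (hw : Function.Injective w) :
    (Finset.univ.filter fun p : Fin (n + 1) × Fin (n + 1) => IsRun w p.1 p.2).card =
      numAlternatingRuns w := by
  classical
  rw [numAlternatingRuns]
  split_ifs with hn
  · rw [Finset.card_eq_zero]
    refine Finset.filter_eq_empty_iff.2 ?_
    rintro ⟨a, b⟩ - ⟨h, -⟩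
    have := Fin.lt_def.1 h
    dsimp only at this
    omega
  · have h0 : (0 : Fin (n + 1)) ∉ Finset.univ.filter fun i => ChangesDirectionAt w i := by
      simpa using changesDirectionAt_zero w
    have hmem : ∀ a : Fin (n + 1),
        a ∈ insert 0 (Finset.univ.filter fun i => ChangesDirectionAt w i) ↔
          (a : ℕ) = 0 ∨ ChangesDirectionAt w a := fun a => by
      rw [Finset.mem_insert, Finset.mem_filter, Fin.ext_iff, Fin.val_zero]
      simp only [Finset.mem_univ, true_and]
    rw [← Finset.card_insert_of_notMem h0]
    refine Finset.card_bij (fun p _ => p.1) ?_ ?_ ?_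
    · rintro ⟨a, b⟩ h
      exact (hmem a).2 ((Finset.mem_filter.1 h).2.eq_zero_or_changesDirectionAt hw)
    · rintro ⟨a, b⟩ h ⟨a', b'⟩ h' (rfl : a = a')
      have h := (Finset.mem_filter.1 h).2
      have h' := (Finset.mem_filter.1 h').2
      rcases le_total b b' with hb | hb
      · rw [(h.2.2 a b' le_rfl hb h'.2.1).2]
      · rw [(h'.2.2 a b le_rfl hb h.2.1).2]
    · intro a ha
      have ha' := (hmem a).1 ha
      have ham : (a : ℕ) + 1 < n + 1 := by
        rcases ha' with h | ⟨_, c, _, hc, _⟩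
        · omega
        · omega
      obtain ⟨b, hb⟩ := exists_isRun hw ham ha'
      exact ⟨(a, b), by simpa using hb, rfl⟩

theorem signedWord_injective {n : ℕ} (π : SignedPerm n) : Function.Injective (signedWord π) := by
  refine Fin.cons_injective_iff.2 ⟨?_, ?_⟩
  · rintro ⟨i, hi⟩
    exact (Finset.mem_erase.1 (π.1 (PMSet.pos i)).2).1 hi
  · intro i j hij
    have h := π.1.injective (Subtype.ext hij)
    have h' : ((i : ℕ) : ℤ) + 1 = (j : ℕ) + 1 := congrArg Subtype.val h
    ext
    omega

theorem numSignedRuns_eq {n : ℕ} (π : SignedPerm n) :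
    numSignedRuns π = numAlternatingRuns (signedWord π) :=
  card_isRun (signedWord_injective π)

/-! ### Run polynomials as sums over permutations. -/

theorem sum_card_filter_mul_X_pow {α : Type*} (s : Finset α) (r : α → ℕ) (K : Finset ℕ)
    (h : ∀ a ∈ s, r a ∈ K) :
    ∑ k ∈ K, ((s.filter fun a => r a = k).card : ℤ[X]) * X ^ k = ∑ a ∈ s, X ^ r a := by
  rw [← Finset.sum_fiberwise_of_maps_to h]
  refine Finset.sum_congr rfl fun k _ => ?_
  rw [Finset.sum_congr rfl (g := fun _ => X ^ k) fun a ha => by rw [(Finset.mem_filter.1 ha).2]]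
  simp

theorem upDownRunPoly_eq_sum (n : ℕ) :
    upDownRunPoly n = ∑ π : Equiv.Perm (Fin n), X ^ numUpDownRuns π :=
  sum_card_filter_mul_X_pow _ _ _ fun π _ =>
    Finset.mem_Icc.2 ⟨Nat.zero_le _, numAlternatingRuns_le (permWord π)⟩

theorem altRunPolyB_eq_sum {n : ℕ} (hn : 1 ≤ n) :
    altRunPolyB n = ∑ π : SignedPerm n with IsUp π, X ^ numAlternatingRuns (signedWord π) := by
  rw [← sum_card_filter_mul_X_pow _ _ (Finset.Icc 1 n) fun π _ => Finset.mem_Icc.2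
    ⟨one_le_numAlternatingRuns hn _, numAlternatingRuns_le _⟩]
  simp only [altRunPolyB, T, numSignedRuns_eq, Finset.filter_filter]

/-! ### Orderings and signed arrangements of a finite set. -/

/-- The lists in which every element of `Z` occurs once and nothing else occurs. -/
def orderings (Z : Finset ℤ) : Finset (List ℤ) :=
  Z.val.lists.toFinset

theorem mem_orderings {Z : Finset ℤ} {l : List ℤ} :
    l ∈ orderings Z ↔ Z.val = (l : Multiset ℤ) := by
  rw [orderings, Multiset.mem_toFinset, Multiset.mem_lists_iff]
  rfl

/-- The set of integers obtained from `S` by changing the signs of the elements outside `D`. -/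
def signedSet (S D : Finset ℕ) : Finset ℤ :=
  S.image fun s => if s ∈ D then (s : ℤ) else -s

theorem natAbs_ite_neg (s : ℕ) (p : Prop) [Decidable p] :
    (if p then (s : ℤ) else -s).natAbs = s := by
  split_ifs <;> simp

theorem injective_ite_neg (D : Finset ℕ) :
    Function.Injective fun s : ℕ => if s ∈ D then (s : ℤ) else -s := fun s t h => by
  simpa only [natAbs_ite_neg] using congrArg Int.natAbs h

theorem card_signedSet (S D : Finset ℕ) : (signedSet S D).card = S.card :=
  Finset.card_image_of_injective _ (injective_ite_neg D)

theorem natAbs_mem_of_mem_signedSet {S D : Finset ℕ} {z : ℤ} (hz : z ∈ signedSet S D) :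
    z.natAbs ∈ S := by
  obtain ⟨s, hs, rfl⟩ := Finset.mem_image.1 hz
  rwa [natAbs_ite_neg]

theorem natCast_mem_signedSet {S D : Finset ℕ} (h0 : 0 ∉ S) {s : ℕ} (hs : s ∈ S) :
    (s : ℤ) ∈ signedSet S D ↔ s ∈ D := by
  constructor
  · intro h
    obtain ⟨t, ht, hts⟩ := Finset.mem_image.1 h
    have : t = s := by simpa only [natAbs_ite_neg, Int.natAbs_natCast] using congrArg Int.natAbs hts
    subst this
    by_contra hD
    rw [if_neg hD] at hts
    have : t = 0 := by omega
    exact h0 (this ▸ ht)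
  · intro h
    exact Finset.mem_image.2 ⟨s, hs, if_pos h⟩

/-- The signed arrangements of `S`: the lists in which every element of `S` occurs once,
with an arbitrary sign, and nothing else occurs. -/
def arrangements (S : Finset ℕ) : Finset (List ℤ) :=
  S.powerset.biUnion fun D => orderings (signedSet S D)

theorem mem_arrangements {S : Finset ℕ} {l : List ℤ} :
    l ∈ arrangements S ↔ ((l.map Int.natAbs : List ℕ) : Multiset ℕ) = S.val := by
  simp only [arrangements, Finset.mem_biUnion, mem_orderings, Finset.mem_powerset]
  constructor
  · rintro ⟨D, -, h⟩
    rw [← Multiset.map_coe, ← h, signedSet,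
      Finset.image_val_of_injOn (injective_ite_neg D).injOn, Multiset.map_map]
    simp only [Function.comp_def, natAbs_ite_neg, Multiset.map_id']
  · intro h
    have hmem : ∀ s, s ∈ S ↔ ∃ z ∈ l, z.natAbs = s := fun s => by
      rw [← Finset.mem_val, ← h]; simp
    have hnd : (l.map Int.natAbs).Nodup := Multiset.coe_nodup.1 (h ▸ S.nodup)
    -- The unnegated elements are those that occur in `l` with a positive sign.
    refine ⟨S.filter fun s => (s : ℤ) ∈ l, Finset.filter_subset _ _, ?_⟩
    refine (Multiset.Nodup.ext (Finset.nodup _) (Multiset.coe_nodup.2 hnd.of_map)).2 fun z => ?_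
    rw [Finset.mem_val, Multiset.mem_coe, signedSet, Finset.mem_image]
    constructor
    · rintro ⟨s, hs, rfl⟩
      simp only [Finset.mem_filter, hs, true_and]
      split_ifs with hl
      · exact hl
      · obtain ⟨z, hz, rfl⟩ := (hmem s).1 hs
        rcases Int.natAbs_eq z with h | h
        · exact absurd (h ▸ hz) hl
        · exact h ▸ hz
    · intro hz
      have hzS := (hmem _).2 ⟨z, hz, rfl⟩
      refine ⟨z.natAbs, hzS, ?_⟩
      simp only [Finset.mem_filter, hzS, true_and]
      split_ifs with hl
      · exact List.inj_on_of_nodup_map hnd hl hz (Int.natAbs_natCast _)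
      · rcases Int.natAbs_eq z with h | h
        · exact absurd (h ▸ hz) hl
        · exact h.symm

/-- The union over sign choices is disjoint: as `0 ∉ S`, each `s` differs from `-s`, so the signed
set determines `D`. -/
theorem sum_arrangements {S : Finset ℕ} (h0 : 0 ∉ S) (f : List ℤ → ℤ[X]) :
    ∑ l ∈ arrangements S, f l =
      ∑ D ∈ S.powerset, ∑ l ∈ orderings (signedSet S D), f l := by
  refine Finset.sum_biUnion fun D hD D' hD' hne => Finset.disjoint_left.2 fun l hl hl' => hne ?_
  have heq : signedSet S D = signedSet S D' :=
    Finset.val_injective ((mem_orderings.1 hl).trans (mem_orderings.1 hl').symm)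
  have hD := Finset.mem_powerset.1 hD
  have hD' := Finset.mem_powerset.1 hD'
  ext s
  constructor
  · exact fun h => (natCast_mem_signedSet h0 (hD h)).1 (heq ▸ (natCast_mem_signedSet h0 (hD h)).2 h)
  · exact fun h =>
      (natCast_mem_signedSet h0 (hD' h)).1 (heq ▸ (natCast_mem_signedSet h0 (hD' h)).2 h)

theorem sum_orderings_eq_sum_perm {m : ℕ} {Z : Finset ℤ} {e : Fin m → ℤ} (he : Function.Injective e)
    (hZ : ∀ z, z ∈ Z ↔ ∃ i, e i = z) (f : List ℤ → ℤ[X]) :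
    ∑ l ∈ orderings Z, f l = ∑ π : Equiv.Perm (Fin m), f (List.ofFn fun i => e (π i)) := by
  symm
  refine Finset.sum_bij (fun π _ => List.ofFn fun i => e (π i)) ?_ ?_ ?_ fun _ _ => rfl
  · intro π _
    rw [mem_orderings]
    refine (Multiset.Nodup.ext Z.nodup (Multiset.coe_nodup.2
      (List.nodup_ofFn.2 (he.comp π.injective)))).2 fun z => ?_
    rw [Finset.mem_val, hZ, Multiset.mem_coe, List.mem_ofFn]
    exact π.surjective.exists
  · intro π _ π' _ h
    ext i
    rw [he (congrFun (List.ofFn_injective h) i)]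
  · intro l hl
    have hl : Z.val = (l : Multiset ℤ) := mem_orderings.1 hl
    have hZe : Z = Finset.univ.image e := by ext z; simp [hZ]
    have hlen : l.length = m := by
      have := congrArg Multiset.card hl
      rw [Multiset.coe_card, Finset.card_val, hZe, Finset.card_image_of_injective _ he] at this
      simpa using this.symm
    subst hlen
    have hnd : l.Nodup := Multiset.coe_nodup.1 (hl ▸ Z.nodup)
    have hex : ∀ i : Fin l.length, ∃ j, e j = l.get i := fun i =>
      (hZ _).1 (by rw [← Finset.mem_val, hl]; exact l.get_mem i)
    choose p hp using hex
    have hpinj : Function.Injective p := fun i j hij =>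
      List.nodup_iff_injective_get.1 hnd (by rw [← hp i, ← hp j, hij])
    refine ⟨Equiv.ofBijective p (Finite.injective_iff_bijective.1 hpinj), Finset.mem_univ _, ?_⟩
    simp only [Equiv.ofBijective_apply, hp]
    exact List.ofFn_get l

/-- Runs depend only on relative order and are unchanged when the order is reversed. So `N` can play
the role of the initial `0`: enumerate `Z` increasingly if `N` lies below it, decreasingly if above.
-/
theorem sum_orderings_pow_listRuns {Z : Finset ℤ} {N : ℤ} (h : (∀ z ∈ Z, z < N) ∨ (∀ z ∈ Z, N < z)) :
    ∑ l ∈ orderings Z, (X : ℤ[X]) ^ listRuns (N :: l) = upDownRunPoly Z.card := by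
  rw [upDownRunPoly_eq_sum]
  have hmem : ∀ i, Z.orderEmbOfFin rfl i ∈ Z := Z.orderEmbOfFin_mem rfl
  have hrange : ∀ z, z ∈ Z ↔ ∃ i, Z.orderEmbOfFin rfl i = z := fun z => by
    rw [← Finset.mem_coe, ← Z.range_orderEmbOfFin rfl, Set.mem_range]
  rcases h with h | h
  · have hrange' : ∀ z, z ∈ Z ↔ ∃ i, Z.orderEmbOfFin rfl (Fin.rev i) = z := fun z =>
      (hrange z).trans Fin.revPerm.surjective.exists
    rw [sum_orderings_eq_sum_perm ((Z.orderEmbOfFin rfl).injective.comp Fin.rev_injective) hrange']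
    refine Finset.sum_congr rfl fun π _ => ?_
    rw [numUpDownRuns, permWord, ← List.ofFn_cons, ← numAlternatingRuns_eq_listRuns]
    congr 1
    refine numAlternatingRuns_congr_reverse fun i j => ?_
    induction i using Fin.cases with
    | zero =>
      induction j using Fin.cases with
      | zero => simp
      | succ j =>
        simp only [Fin.cons_zero, Fin.cons_succ, Function.comp_apply]
        have := h _ (hmem (Fin.rev (π j)))
        constructor <;> intro <;> omega
    | succ i =>
      induction j using Fin.cases with
      | zero =>
        simp only [Fin.cons_zero, Fin.cons_succ, Function.comp_apply]
        have := h _ (hmem (Fin.rev (π i)))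
        constructor <;> intro <;> omega
      | succ j => simp
  · rw [sum_orderings_eq_sum_perm (Z.orderEmbOfFin rfl).injective hrange]
    refine Finset.sum_congr rfl fun π _ => ?_
    rw [numUpDownRuns, permWord, ← List.ofFn_cons, ← numAlternatingRuns_eq_listRuns]
    congr 1
    refine numAlternatingRuns_congr fun i j => ?_
    induction i using Fin.cases with
    | zero =>
      induction j using Fin.cases with
      | zero => simp
      | succ j =>
        simp only [Fin.cons_zero, Fin.cons_succ]
        have := h _ (hmem (π j))
        constructor <;> intro <;> omega
    | succ i =>
      induction j using Fin.cases with
      | zero =>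
        simp only [Fin.cons_zero, Fin.cons_succ]
        have := h _ (hmem (π i))
        constructor <;> intro <;> omega
      | succ j => simp

/-- Each of the `2 ^ S.card` sign choices leaves `N` on one side of all letters and so contributes
the same polynomial. The bound on `|N|` covers both signs of the cutting letter. -/
theorem sum_arrangements_pow_listRuns {S : Finset ℕ} (h0 : 0 ∉ S) {N : ℤ}
    (h : ∀ s ∈ S, (s : ℤ) < |N|) :
    ∑ l ∈ arrangements S, (X : ℤ[X]) ^ listRuns (N :: l) =
      2 ^ S.card * upDownRunPoly S.card := by
  rw [sum_arrangements h0, Finset.sum_congr rfl (g := fun _ => upDownRunPoly S.card)]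
  · rw [Finset.sum_const, Finset.card_powerset, nsmul_eq_mul]
    push_cast
    rfl
  · intro D _
    have hlt : ∀ z ∈ signedSet S D, |z| < |N| := fun z hz => by
      have := h _ (natAbs_mem_of_mem_signedSet hz)
      rwa [Int.natCast_natAbs] at this
    rw [← card_signedSet S D]
    refine sum_orderings_pow_listRuns ?_
    rcases le_total 0 N with hN | hN
    · left
      intro z hz
      have := hlt z hz
      rw [abs_of_nonneg hN] at this
      exact (abs_lt.1 this).2
    · right
      intro z hz
      have := hlt z hz
      rw [abs_of_nonpos hN] at this
      have := (abs_lt.1 this).1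
      omega

/-! ### Standardization: arrangements as signed permutations. -/

/-- The odd extension to the integers of a function on the natural numbers. -/
def oddExtension (g : ℕ → ℕ) (z : ℤ) : ℤ :=
  if 0 ≤ z then (g z.natAbs : ℤ) else -(g z.natAbs : ℤ)

theorem natAbs_oddExtension (g : ℕ → ℕ) (z : ℤ) : (oddExtension g z).natAbs = g z.natAbs := by
  unfold oddExtension
  split_ifs <;> simp

theorem oddExtension_zero {g : ℕ → ℕ} (g0 : g 0 = 0) : oddExtension g 0 = 0 := by
  simp [oddExtension, g0]

theorem strictMono_oddExtension {g : ℕ → ℕ} (hg : StrictMono g) (g0 : g 0 = 0) :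
    StrictMono (oddExtension g) := by
  intro a b hab
  have hpos : ∀ c, 0 < c → 0 < g c := fun c hc => g0 ▸ hg hc
  unfold oddExtension
  split_ifs with ha hb hb
  · have : g a.natAbs < g b.natAbs := hg (by omega)
    omega
  · omega
  · have := hpos a.natAbs (by omega)
    omega
  · have : g b.natAbs < g a.natAbs := hg (by omega)
    omega

theorem exists_strictMono_image_Icc (P : Finset ℕ) (h0 : 0 ∉ P) :
    ∃ g : ℕ → ℕ, StrictMono g ∧ g 0 = 0 ∧ (Finset.Icc 1 P.card).image g = P := by
  induction P using Finset.induction_on_max with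
  | empty => exact ⟨id, strictMono_id, rfl, by simp⟩
  | insert a s hs ih =>
    obtain ⟨g, hg, g0, him⟩ := ih fun h => h0 (Finset.mem_insert_of_mem h)
    have has : a ∉ s := fun h => lt_irrefl _ (hs a h)
    have ha : 0 < a := Nat.pos_of_ne_zero fun h => h0 (by simp [h])
    have hlt : ∀ i, i ≤ s.card → g i < a := fun i hi => by
      rcases Nat.eq_zero_or_pos i with rfl | hi0
      · omega
      · exact hs _ (him ▸ Finset.mem_image_of_mem g (Finset.mem_Icc.2 ⟨hi0, hi⟩))
    -- The next index goes to the new maximum `a`; later values are consecutive integers, which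
    -- keeps `g` strictly increasing on all of `ℕ`.
    refine ⟨fun i => if i ≤ s.card then g i else a + (i - (s.card + 1)), ?_, by simp [g0], ?_⟩
    · intro i j hij
      dsimp only
      split_ifs with h1 h2 h2
      · exact hg hij
      · have := hlt i h1
        omega
      · omega
      · omega
    · rw [Finset.card_insert_of_notMem has, ← Finset.insert_Icc_right_eq_Icc_add_one (by omega),
        Finset.image_insert]
      congr 1
      · rw [if_neg (by omega)]
        omega
      · exact (Finset.image_congr fun i hi => if_pos (Finset.mem_Icc.1 hi).2).trans him

/-- The element `-z` of `±[n]`. -/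
def PMSet.neg {n : ℕ} (z : PMSet n) : PMSet n :=
  ⟨-z, by
    have := z.2
    simp only [Finset.mem_erase, Finset.mem_Icc] at this ⊢
    omega⟩

theorem PMSet.bounds {n : ℕ} (z : PMSet n) :
    (z : ℤ) ≠ 0 ∧ 1 ≤ (z : ℤ).natAbs ∧ (z : ℤ).natAbs ≤ n := by
  have := z.2
  simp only [Finset.mem_erase, Finset.mem_Icc] at this
  omega

theorem PMSet.eq_pos_or_eq_neg {n : ℕ} (z : PMSet n) :
    ∃ i : Fin n, (i : ℕ) + 1 = (z : ℤ).natAbs ∧ (z = PMSet.pos i ∨ z = (PMSet.pos i).neg) := by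
  have h := z.bounds
  refine ⟨⟨(z : ℤ).natAbs - 1, by omega⟩, by simp only; omega, ?_⟩
  rcases lt_or_gt_of_ne h.1 with h' | h'
  · right
    ext
    simp only [PMSet.neg, PMSet.pos]
    omega
  · left
    ext
    simp only [PMSet.pos]
    omega

theorem SignedPerm.apply_neg {n : ℕ} (π : SignedPerm n) (z : PMSet n) :
    (π.1 z.neg : ℤ) = -(π.1 z : ℤ) :=
  π.2 z z.neg rfl

theorem SignedPerm.natAbs_apply_pos_injective {n : ℕ} (π : SignedPerm n) :
    Function.Injective fun i : Fin n => (π.1 (PMSet.pos i) : ℤ).natAbs := by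
  intro i j hij
  rcases Int.natAbs_eq_natAbs_iff.1 hij with h | h
  · have h := congrArg Subtype.val (π.1.injective (Subtype.ext h))
    simp only [PMSet.pos] at h
    ext
    omega
  · rw [← π.apply_neg] at h
    have h := congrArg Subtype.val (π.1.injective (Subtype.ext h))
    simp only [PMSet.pos, PMSet.neg] at h
    omega

theorem SignedPerm.ext_pos {n : ℕ} {π π' : SignedPerm n}
    (h : ∀ i, (π.1 (PMSet.pos i) : ℤ) = π'.1 (PMSet.pos i)) : π = π' := by
  refine Subtype.ext (Equiv.ext fun z => Subtype.ext ?_)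
  obtain ⟨i, -, rfl | rfl⟩ := z.eq_pos_or_eq_neg
  · exact h i
  · rw [π.apply_neg, π'.apply_neg, h i]

/-- Extend `q` oddly. Distinct absolute values make the extension injective, hence bijective on a
finite set. -/
theorem SignedPerm.exists_apply_pos_eq {n : ℕ} {q : Fin n → PMSet n}
    (hq : Function.Injective fun i => (q i : ℤ).natAbs) :
    ∃ π : SignedPerm n, ∀ i, π.1 (PMSet.pos i) = q i := by
  let idx : PMSet n → Fin n := fun z => ⟨(z : ℤ).natAbs - 1, by have := z.bounds; omega⟩
  let p : PMSet n → PMSet n := fun z => if 0 < (z : ℤ) then q (idx z) else (q (idx z)).neg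
  have hpabs : ∀ z, (p z : ℤ).natAbs = (q (idx z) : ℤ).natAbs := fun z => by
    simp only [p]
    split_ifs
    · rfl
    · simp [PMSet.neg]
  have hodd : ∀ i j : PMSet n, (j : ℤ) = -(i : ℤ) → (p j : ℤ) = -(p i : ℤ) := fun i j hij => by
    have hidx : idx j = idx i := by
      ext
      simp only [idx]
      omega
    have := i.bounds
    simp only [p, hidx]
    split_ifs with h1 h2 h2
    · omega
    · simp [PMSet.neg]
    · simp [PMSet.neg]
    · omega
  have hinj : Function.Injective p := fun z z' h => by
    have h1 : idx z = idx z' := hq (by simp only [← hpabs, h])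
    have h2 := congrArg Fin.val h1
    simp only [idx] at h2
    have hz := z.bounds
    have hz' := z'.bounds
    have h3 : (z : ℤ).natAbs = (z' : ℤ).natAbs := by omega
    rcases Int.natAbs_eq_natAbs_iff.1 h3 with h4 | h4
    · exact Subtype.ext h4
    · have h5 := hodd z' z h4
      rw [h] at h5
      have := (p z').bounds
      omega
  refine ⟨⟨Equiv.ofBijective p (Finite.injective_iff_bijective.1 hinj), hodd⟩, fun i => ?_⟩
  have hidx : idx (PMSet.pos i) = i := by
    ext
    simp only [idx, PMSet.pos]
    omega
  have hpos : 0 < (PMSet.pos i : ℤ) := by simp only [PMSet.pos]; omega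
  simp only [Equiv.ofBijective_apply, p, hidx, if_pos hpos]

/-- Relabelling absolute values by `g` while keeping signs is a bijection from signed permutations
onto the arrangements of `P`. -/
theorem sum_arrangements_eq_sum_signedPerm {k : ℕ} {P : Finset ℕ} {g : ℕ → ℕ}
    (hg : StrictMono g) (g0 : g 0 = 0) (him : (Finset.Icc 1 k).image g = P) (f : List ℤ → ℤ[X]) :
    ∑ l ∈ arrangements P, f l =
      ∑ π : SignedPerm k, f (List.ofFn fun i => oddExtension g (π.1 (PMSet.pos i))) := by
  have hF := strictMono_oddExtension hg g0
  have hcard : P.card = k := by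
    rw [← him, Finset.card_image_of_injective _ hg.injective]
    simp
  symm
  refine Finset.sum_bij
    (fun π _ => List.ofFn fun i => oddExtension g (π.1 (PMSet.pos i))) ?_ ?_ ?_ fun _ _ => rfl
  · intro π _
    rw [mem_arrangements, List.map_ofFn]
    have hnd : (List.ofFn
        (Int.natAbs ∘ fun i => oddExtension g (π.1 (PMSet.pos i)))).Nodup := by
      refine List.nodup_ofFn.2 fun i j hij => ?_
      simp only [Function.comp_apply, natAbs_oddExtension] at hij
      exact π.natAbs_apply_pos_injective (hg.injective hij)
    have hsub : (⟨_, Multiset.coe_nodup.2 hnd⟩ : Finset ℕ) ⊆ P := fun s hs => by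
      obtain ⟨i, rfl⟩ := List.mem_ofFn.1 (Multiset.mem_coe.1 (Finset.mem_mk.1 hs))
      rw [← him, Function.comp_apply, natAbs_oddExtension]
      exact Finset.mem_image_of_mem g (Finset.mem_Icc.2 (π.1 (PMSet.pos i)).bounds.2)
    exact congrArg Finset.val (Finset.eq_of_subset_of_card_le hsub (by simp [hcard]))
  · intro π _ π' _ h
    exact SignedPerm.ext_pos fun i => hF.injective (congrFun (List.ofFn_injective h) i)
  · intro l hl
    rw [mem_arrangements] at hl
    have hlen : l.length = k := by
      have := congrArg Multiset.card hl
      simpa [hcard] using this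
    subst hlen
    have hnd : (l.map Int.natAbs).Nodup := Multiset.coe_nodup.1 (hl ▸ P.nodup)
    have hex : ∀ i : Fin l.length, ∃ j : PMSet l.length, oddExtension g j = l.get i := fun i => by
      have hi : (l.get i).natAbs ∈ P := by
        rw [← Finset.mem_val, ← hl]
        exact Multiset.mem_coe.2 (List.mem_map_of_mem (l.get_mem i))
      rw [← him] at hi
      obtain ⟨c, hc, hcl⟩ := Finset.mem_image.1 hi
      have hc := Finset.mem_Icc.1 hc
      rcases le_or_gt 0 (l.get i) with hs | hs
      · refine ⟨⟨c, by simp only [Finset.mem_erase, Finset.mem_Icc]; omega⟩, ?_⟩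
        simp only [oddExtension, Int.natAbs_natCast, hcl]
        rw [if_pos (by omega)]
        omega
      · refine ⟨⟨-c, by simp only [Finset.mem_erase, Finset.mem_Icc]; omega⟩, ?_⟩
        simp only [oddExtension, Int.natAbs_neg, Int.natAbs_natCast, hcl]
        rw [if_neg (by omega)]
        omega
    choose q hq using hex
    have hqinj : Function.Injective fun i => (q i : ℤ).natAbs := fun i j hij => by
      have hij : (q i : ℤ).natAbs = (q j : ℤ).natAbs := hij
      have h : (l.get i).natAbs = (l.get j).natAbs := by
        rw [← hq, ← hq, natAbs_oddExtension, natAbs_oddExtension, hij]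
      exact List.nodup_iff_injective_get.1 hnd.of_map
        (List.inj_on_of_nodup_map hnd (l.get_mem i) (l.get_mem j) h)
    obtain ⟨π, hπ⟩ := SignedPerm.exists_apply_pos_eq hqinj
    refine ⟨π, Finset.mem_univ _, ?_⟩
    simp only [hπ, hq]
    exact List.ofFn_get l

theorem isUp_iff {k : ℕ} (π : SignedPerm (k + 1)) : IsUp π ↔ 0 < (π.1 (PMSet.pos 0) : ℤ) := by
  constructor
  · intro h
    exact h _ (by simp [PMSet.pos])
  · intro h i hi
    have : i = PMSet.pos 0 := by
      ext
      simp [PMSet.pos, hi]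
    rwa [this]

/-- The odd extension of an increasing enumeration of `P` is strictly increasing and fixes `0`, so
relabelling preserves both the runs after the initial `0` and the sign of the first letter. -/
theorem sum_arrangements_up {P : Finset ℕ} (h0 : 0 ∉ P) (hP : P.Nonempty) :
    ∑ l ∈ arrangements P, (if 0 < l.headI then (X : ℤ[X]) ^ listRuns (0 :: l) else 0) =
      altRunPolyB P.card := by
  obtain ⟨g, hg, g0, him⟩ := exists_strictMono_image_Icc P h0
  have hF := strictMono_oddExtension hg g0
  rw [sum_arrangements_eq_sum_signedPerm hg g0 him,
    altRunPolyB_eq_sum (Finset.card_pos.2 hP), Finset.sum_filter]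
  generalize hk : P.card = k
  obtain ⟨k, rfl⟩ : ∃ j, k = j + 1 := ⟨k - 1, by have := Finset.card_pos.2 hP; omega⟩
  refine Finset.sum_congr rfl fun π _ => ?_
  have hup : 0 < (List.ofFn fun i => oddExtension g (π.1 (PMSet.pos i))).headI ↔ IsUp π := by
    rw [isUp_iff, List.ofFn_succ, List.headI_cons]
    have := hF.lt_iff_lt (a := 0) (b := (π.1 (PMSet.pos 0) : ℤ))
    rwa [oddExtension_zero g0] at this
  simp only [hup]
  split_ifs
  · rw [← List.ofFn_cons, ← numAlternatingRuns_eq_listRuns]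
    congr 1
    have hcons : (Fin.cons 0 fun i => oddExtension g (π.1 (PMSet.pos i)) : Fin (k + 2) → ℤ) =
        fun i => oddExtension g (signedWord π i) := by
      funext i
      induction i using Fin.cases with
      | zero => simp [signedWord, oddExtension_zero g0]
      | succ i => simp [signedWord]
    rw [hcons]
    exact numAlternatingRuns_congr fun i j => hF.lt_iff_lt
  · rfl

/-! ### Splitting an arrangement at its letter `±N`. -/

theorem natAbs_mem_of_mem_arrangements {S : Finset ℕ} {l : List ℤ}
    (hl : l ∈ arrangements S) {z : ℤ} (hz : z ∈ l) : z.natAbs ∈ S := by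
  rw [← Finset.mem_val, ← mem_arrangements.1 hl]
  exact Multiset.mem_coe.2 (List.mem_map_of_mem hz)

theorem nodup_of_mem_arrangements {S : Finset ℕ} {l : List ℤ}
    (hl : l ∈ arrangements S) : l.Nodup :=
  (Multiset.coe_nodup.1 (mem_arrangements.1 hl ▸ S.nodup)).of_map

theorem ne_nil_of_mem_arrangements {S : Finset ℕ} (hS : S.Nonempty) {l : List ℤ}
    (hl : l ∈ arrangements S) : l ≠ [] := by
  rintro rfl
  have := congrArg Multiset.card (mem_arrangements.1 hl)
  simp only [List.map_nil, Multiset.coe_card, List.length_nil, Finset.card_val] at this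
  exact hS.ne_empty (Finset.card_eq_zero.1 this.symm)

theorem arrangements_empty : arrangements ∅ = {[]} := by
  ext l
  rw [mem_arrangements]
  simp

/-- The letter of absolute value `N` occurs exactly once; `P` is the set of absolute values to its
left. -/
theorem sum_arrangements_insert {S : Finset ℕ} {N : ℕ} (hN0 : N ≠ 0) (hN : N ∉ S)
    (f : List ℤ → ℤ[X]) :
    ∑ l ∈ arrangements (insert N S), f l =
      ∑ P ∈ S.powerset, ∑ u ∈ arrangements P, ∑ v ∈ arrangements (S \ P),
        (f (u ++ (N : ℤ) :: v) + f (u ++ (-N : ℤ) :: v)) := by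
  have hpair : (N : ℤ) ≠ -N := by omega
  have hsum : ∀ u v, f (u ++ (N : ℤ) :: v) + f (u ++ (-N : ℤ) :: v) =
      ∑ e ∈ {(N : ℤ), -(N : ℤ)}, f (u ++ e :: v) := fun u v =>
    (Finset.sum_pair (f := fun e : ℤ => f (u ++ e :: v)) hpair).symm
  have habs : ∀ {e : ℤ}, e ∈ ({(N : ℤ), -(N : ℤ)} : Finset ℤ) ↔ e.natAbs = N := fun {e} => by
    rw [Finset.mem_insert, Finset.mem_singleton]
    omega
  simp only [hsum, Finset.sum_sigma']
  symm
  refine Finset.sum_bij (fun x _ => x.2.1 ++ x.2.2.2 :: x.2.2.1) ?_ ?_ ?_ fun _ _ => rfl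
  · rintro ⟨P, u, v, e⟩ hx
    simp only [Finset.mem_sigma, Finset.mem_powerset, habs] at hx
    obtain ⟨hP, hu, hv, he⟩ := hx
    rw [mem_arrangements] at hu hv ⊢
    rw [List.map_append, List.map_cons, ← Multiset.coe_add, ← Multiset.cons_coe, hu, hv, he,
      Multiset.add_cons, Finset.insert_val_of_notMem hN, Finset.sdiff_val,
      add_tsub_cancel_of_le (Finset.val_le_iff.2 hP)]
  · rintro ⟨P, u, v, e⟩ hx ⟨P', u', v', e'⟩ hx' h
    simp only [Finset.mem_sigma, Finset.mem_powerset, habs] at hx hx'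
    obtain ⟨hP, hu, hv, he⟩ := hx
    obtain ⟨hP', hu', hv', he'⟩ := hx'
    -- Neither `u` nor `v` contains a letter of absolute value `N`, so the place of the cut is
    -- unique.
    have hu_notMem : e' ∉ u := fun hmem =>
      hN (hP (he' ▸ natAbs_mem_of_mem_arrangements hu hmem))
    have hv_notMem : e' ∉ v := fun hmem =>
      hN (Finset.mem_sdiff.1 (he' ▸ natAbs_mem_of_mem_arrangements hv hmem)).1
    obtain ⟨rfl, rfl, rfl⟩ := (List.append_cons_inj_of_notMem hu_notMem hv_notMem).1 h
    obtain rfl : P = P' :=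
      Finset.val_injective ((mem_arrangements.1 hu).symm.trans (mem_arrangements.1 hu'))
    rfl
  · intro l hl
    have hl' := mem_arrangements.1 hl
    have hNl : N ∈ l.map Int.natAbs := by
      rw [← Multiset.mem_coe, hl', Finset.mem_val]
      exact Finset.mem_insert_self _ _
    obtain ⟨e, hel, he⟩ := List.mem_map.1 hNl
    obtain ⟨u, v, rfl⟩ := List.append_of_mem hel
    rw [List.map_append, List.map_cons, ← Multiset.coe_add, ← Multiset.cons_coe, he,
      Multiset.add_cons, Finset.insert_val_of_notMem hN, Multiset.cons_inj_right] at hl'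
    have hnd : ((u.map Int.natAbs : List ℕ) : Multiset ℕ).Nodup :=
      Multiset.nodup_of_le (Multiset.le_add_right _ _) (hl' ▸ S.nodup)
    refine ⟨⟨⟨_, hnd⟩, u, v, e⟩, ?_, rfl⟩
    simp only [Finset.mem_sigma, Finset.mem_powerset, habs, mem_arrangements, he,
      and_true, Finset.sdiff_val, ← hl', add_tsub_cancel_left]
    exact Finset.val_le_iff.1 (hl' ▸ Multiset.le_add_right _ _)

/-! ### Summing weights and the recurrence. -/

/-- The weight `x ^ k` of a list that starts with a positive letter and has `k` alternating runs
when preceded by `0`; all other lists have weight `0`. -/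
noncomputable def upWeight (l : List ℤ) : ℤ[X] :=
  if 0 < l.headI then X ^ listRuns (0 :: l) else 0

theorem upWeight_append_cons {u v : List ℤ} {N : ℤ} (hu : u ≠ [])
    (h : (∀ z ∈ 0 :: u ++ v, z < N) ∨ (∀ z ∈ 0 :: u ++ v, N < z)) :
    upWeight (u ++ N :: v) =
      (if 0 < u.headI then X ^ listRuns (0 :: u ++ [N]) else 0) * X ^ listRuns (N :: v) := by
  obtain ⟨a, t, rfl⟩ := List.exists_cons_of_ne_nil hu
  rw [upWeight, ← List.cons_append, listRuns_append_cons (by simp) h, pow_add, ite_mul, zero_mul]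
  rfl

theorem natCast_lt_abs_natCast {S : Finset ℕ} {N : ℕ} (hS : ∀ s ∈ S, s < N) :
    ∀ s ∈ S, (s : ℤ) < |(N : ℤ)| := fun s hs => by
  rw [Nat.abs_cast]
  exact_mod_cast hS s hs

/-- For fixed `u`, the sum over `v` does not depend on the sign of `N` and factors out; the two
signs then combine to `1 + X`, leaving the sum of `upWeight u`. -/
theorem sum_upWeight_of_nonempty {S P : Finset ℕ} {N : ℕ} (h0 : 0 ∉ S) (hN : 0 < N)
    (hS : ∀ s ∈ S, s < N) (hPS : P ⊆ S) (hP : P.Nonempty) :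
    ∑ u ∈ arrangements P, ∑ v ∈ arrangements (S \ P),
        (upWeight (u ++ (N : ℤ) :: v) + upWeight (u ++ (-N : ℤ) :: v)) =
      (1 + X) * (2 ^ (S \ P).card * altRunPolyB P.card * upDownRunPoly (S \ P).card) := by
  have h0P : 0 ∉ P := fun h => h0 (hPS h)
  have h0Q : 0 ∉ S \ P := fun h => h0 (Finset.mem_sdiff.1 h).1
  have hQ := natCast_lt_abs_natCast fun s (hs : s ∈ S \ P) => hS s (Finset.mem_sdiff.1 hs).1
  have hu_abs : ∀ u ∈ arrangements P, ∀ z ∈ 0 :: u, |z| < (N : ℤ) := fun u hu z hz => by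
    rcases List.mem_cons.1 hz with rfl | hz
    · simpa using hN
    · have := hS _ (hPS (natAbs_mem_of_mem_arrangements hu hz))
      rw [Int.abs_eq_natAbs]
      exact_mod_cast this
  have hv_abs : ∀ v ∈ arrangements (S \ P), ∀ z ∈ v, |z| < (N : ℤ) := fun v hv z hz => by
    have := hS _ (Finset.mem_sdiff.1 (natAbs_mem_of_mem_arrangements hv hz)).1
    rw [Int.abs_eq_natAbs]
    exact_mod_cast this
  have key : ∀ u ∈ arrangements P, ∑ v ∈ arrangements (S \ P),
      (upWeight (u ++ (N : ℤ) :: v) + upWeight (u ++ (-N : ℤ) :: v)) =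
      upWeight u * ((1 + X) * (2 ^ (S \ P).card * upDownRunPoly (S \ P).card)) := by
    intro u hu
    have hune := ne_nil_of_mem_arrangements hP hu
    have hnd : ((0 : ℤ) :: u).Nodup := List.nodup_cons.2
      ⟨fun h => h0P (natAbs_mem_of_mem_arrangements hu h), nodup_of_mem_arrangements hu⟩
    have habs : ∀ v ∈ arrangements (S \ P), ∀ z ∈ 0 :: u ++ v, |z| < (N : ℤ) :=
      fun v hv z hz => (List.mem_append.1 hz).elim (hu_abs u hu z) (hv_abs v hv z)
    rw [Finset.sum_congr rfl fun v hv => by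
      rw [upWeight_append_cons hune (Or.inl fun z hz => (abs_lt.1 (habs v hv z hz)).2),
        upWeight_append_cons hune (Or.inr fun z hz => (abs_lt.1 (habs v hv z hz)).1)],
      Finset.sum_add_distrib, ← Finset.mul_sum, ← Finset.mul_sum,
      sum_arrangements_pow_listRuns h0Q hQ,
      sum_arrangements_pow_listRuns h0Q (by simpa only [abs_neg] using hQ), ← add_mul, upWeight]
    split_ifs
    · rw [pow_listRuns_add_pow_listRuns X hune hnd (hu_abs u hu)]
      ring
    · ring
  rw [Finset.sum_congr rfl key, ← Finset.sum_mul]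
  simp only [upWeight]
  rw [sum_arrangements_up h0P hP]
  ring

/-- A leading `-N` violates the up condition and has weight `0`; a leading `N` gives one run from
`0` to `N`, followed by the runs of `N :: v`. -/
theorem sum_upWeight_empty {S : Finset ℕ} {N : ℕ} (h0 : 0 ∉ S) (hN : 0 < N)
    (hS : ∀ s ∈ S, s < N) :
    ∑ u ∈ arrangements ∅, ∑ v ∈ arrangements S,
        (upWeight (u ++ (N : ℤ) :: v) + upWeight (u ++ (-N : ℤ) :: v)) =
      2 ^ S.card * X * upDownRunPoly S.card := by
  rw [arrangements_empty, Finset.sum_singleton]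
  have key : ∀ v ∈ arrangements S,
      upWeight ([] ++ (N : ℤ) :: v) + upWeight ([] ++ (-N : ℤ) :: v) =
        X * X ^ listRuns ((N : ℤ) :: v) := by
    intro v hv
    have hlt : ∀ z ∈ [0] ++ v, z < (N : ℤ) := fun z hz => by
      rcases List.mem_cons.1 hz with rfl | hz
      · exact_mod_cast hN
      · have := hS _ (natAbs_mem_of_mem_arrangements hv hz)
        omega
    have hpos : 0 < (N : ℤ) := by exact_mod_cast hN
    have hruns : listRuns (0 :: (N : ℤ) :: v) = 1 + listRuns ((N : ℤ) :: v) :=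
      listRuns_append_cons (u := [0]) (by simp) (Or.inl hlt)
    have hneg : upWeight ((-N : ℤ) :: v) = 0 := if_neg (by rw [List.headI_cons]; omega)
    have hup : upWeight ((N : ℤ) :: v) = X ^ listRuns (0 :: (N : ℤ) :: v) := if_pos hpos
    rw [List.nil_append, List.nil_append, hneg, hup, hruns, pow_add, pow_one, add_zero]
  rw [Finset.sum_congr rfl key, ← Finset.mul_sum,
    sum_arrangements_pow_listRuns h0 (natCast_lt_abs_natCast hS)]
  ring

theorem altRunPolyB_succ (n : ℕ) :
    altRunPolyB (n + 1) =
      2 ^ n * X * upDownRunPoly n +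
        (1 + X) * ∑ k ∈ Finset.Icc 1 n,
          2 ^ (n - k) * (Nat.choose n k : ℤ[X]) * altRunPolyB k * upDownRunPoly (n - k) := by
  have h0 : 0 ∉ Finset.Icc 1 n := by simp
  have h0' : 0 ∉ Finset.Icc 1 (n + 1) := by simp
  have hlt : ∀ s ∈ Finset.Icc 1 n, s < n + 1 := fun s hs =>
    Nat.lt_succ_of_le (Finset.mem_Icc.1 hs).2
  have hcard : (Finset.Icc 1 n).card = n := by simp
  -- The contribution of `P` depends only on its size, whence the binomial coefficients. Size `0`
  -- needs its own value, since `altRunPolyB 0` is an empty sum.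
  let h : ℕ → ℤ[X] := fun k => if k = 0 then 2 ^ n * X * upDownRunPoly n else
    (1 + X) * (2 ^ (n - k) * altRunPolyB k * upDownRunPoly (n - k))
  have hterm : ∀ P ∈ (Finset.Icc 1 n).powerset,
      ∑ u ∈ arrangements P, ∑ v ∈ arrangements (Finset.Icc 1 n \ P),
        (upWeight (u ++ ((n + 1 : ℕ) : ℤ) :: v) + upWeight (u ++ (-(n + 1 : ℕ) : ℤ) :: v)) =
      h P.card := by
    intro P hP
    have hP := Finset.mem_powerset.1 hP
    rcases P.eq_empty_or_nonempty with rfl | hne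
    · rw [Finset.sdiff_empty, sum_upWeight_empty h0 n.succ_pos hlt, hcard]
      rfl
    · rw [sum_upWeight_of_nonempty h0 n.succ_pos hlt hP hne, Finset.card_sdiff_of_subset hP, hcard]
      exact (if_neg hne.card_pos.ne').symm
  have hsum := sum_arrangements_up h0' ⟨1, by simp⟩
  rw [Nat.card_Icc, Nat.add_sub_cancel] at hsum
  rw [← hsum]
  change ∑ l ∈ arrangements (Finset.Icc 1 (n + 1)), upWeight l = _
  rw [← Finset.insert_Icc_right_eq_Icc_add_one (by omega),
    sum_arrangements_insert (N := n + 1) n.succ_ne_zero (by simp), Finset.sum_congr rfl hterm,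
    Finset.sum_powerset_apply_card, hcard, Finset.range_eq_Ico,
    Finset.sum_eq_sum_Ico_succ_bot n.succ_pos, Finset.mul_sum]
  congr 1
  · simp [h]
  · refine Finset.sum_congr rfl fun k hk => ?_
    have hk : k ≠ 0 := by have := (Finset.mem_Icc.1 hk).1; omega
    simp only [h, if_neg hk, nsmul_eq_mul]
    ring

end RunPolynomials

theorem mainTheorem6 (n : ℕ) :
    RunPolynomials.altRunPolyB (n + 1) =
      2 ^ n * Polynomial.X * RunPolynomials.upDownRunPoly n +
        (1 + Polynomial.X) *
          ∑ k ∈ Finset.Icc 1 n,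
            2 ^ (n - k) * (Nat.choose n k : Polynomial ℤ) *
              RunPolynomials.altRunPolyB k * RunPolynomials.upDownRunPoly (n - k) :=
  RunPolynomials.altRunPolyB_succ n
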